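/- **Setting.** A two-player zero-sum game has nonempty parameter sets $\Omega$ (first player, maximizer) and $\Theta$ (second player, minimizer). Parameters $w\in\Omega$, $\theta\in\Theta$ determine models $f_w$, $q_\theta$, which are elements of real vector spaces (functions with pointwise averages, or distributions with mixtures). The payoff is $\varphi(w,\theta)=\tilde\varphi(f_w,q_\theta)$. Let $\mathcal F=\mathrm{conv}\{f_w: w\in\Omega\}$ and $\mathcal G=\mathrm{conv}\{q_\theta:\theta\in\Theta\}$. Assume that $\tilde\varphi$ is bilinear, in the sense that it is compatible with convex combinations in each of its two arguments on $\mathcal F\times\mathcal G$, and that $\varphi$ is $L$-Lipschitz in each parameter, $L>0$. Put $$V=\sup_{f\in\mathcal F}\inf_{q\in\mathcal G}\tilde\varphi(f,q),\quad D_w=\sup_{w,w'\in\Omega,\,\theta\in\Theta}\big(\varphi(w,\theta)-\varphi(w',\theta)\big),\quad D_\theta=\sup_{w\in\Omega,\,\theta,\theta'\in\Theta}\big(\varphi(w,\theta)-\varphi(w,\theta')\big).$$ For $\varepsilon>0$, a pair $(f^*,q^*)\in\mathcal F\times\mathcal G$ is an $\varepsilon$-equilibrium of the convexified game if $\tilde\varphi(f^*,q)\ge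 V-\varepsilon$ for all $q\in\mathcal G$ and $\tilde\varphi(f,q^*)\le V+\varepsilon$ for all $f\in\mathcal F$. Let $(K_\varepsilon^\Omega,K_\varepsilon^\Theta)$ be the smallest numbers $K$, $K'$ such that some convex combination of $K$ models $f_{w_k}$ and some convex combination of $K'$ models $q_{\theta_k}$ form an $\varepsilon$-equilibrium. Let $\mathcal N(A,r)$ be the smallest number of closed balls of radius $r$ with centres in $A$ that cover $A$. **Theorem.** (1) Let $\Omega$ and $\Theta$ be totally bounded (for example compact) subsets of metric spaces. Then $V=\inf_{q\in\mathcal G}\sup_{f\in\mathcal F}\tilde\varphi(f,q)$, the numbers $K_\varepsilon^\Omega$, $K_\varepsilon^\Theta$ exist, and for every $\varepsilon>0$ $$K_\varepsilon^\Omega\le\max\Big\{1,\ \frac{4D_w^2}{\varepsilon^2}\ln\mathcal N\big(\Theta,\tfrac{\varepsilon}{2L}\big)\Big\},\qquad K_\varepsilon^\Theta\le\max\Big\{1,\ \frac{4D_\theta^2}{\varepsilon^2}\ln\mathcal N\big(\Omega,\tfrac{\varepsilon}{2L}\big)\Big\}.$$ Moreover, an $\varepsilon$-equilibrium is reached by uniform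 averages $\big(\frac1K\sum_{k=1}^K f_{w_k},\frac1{K'}\sum_{k=1}^{K'}q_{\theta_k}\big)$ with $K$ and $K'$ satisfying the same bounds. (2) If $\Omega\subset\mathbb R^d$ and $\Theta\subset\mathbb R^p$ with Euclidean norms $\|w\|\le R$ and $\|\theta\|\le R$ for all $w\in\Omega$, $\theta\in\Theta$, then all conclusions of (1) also hold with the two bounds $$\max\Big\{1,\ \frac{4D_w^2\,p}{\varepsilon^2}\ln\frac{4LR\sqrt p}{\varepsilon}\Big\},\qquad \max\Big\{1,\ \frac{4D_\theta^2\,d}{\varepsilon^2}\ln\frac{4LR\sqrt d}{\varepsilon}\Big\}$$ (with the convention $\ln 0=0$). -/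

import Mathlib

open scoped BigOperators

noncomputable section

/-- A two-player zero-sum game with parametrized models. The first player (maximizer) picks a
parameter `w ∈ Ω`, the second player (minimizer) picks `θ ∈ Θ`; the models are `f w` and `q θ`,
which live in real vector spaces `E`, `F` (spaces of functions, or of signed measures when the
models are distributions, so that convex combinations are pointwise averages, or mixtures), and
`modelPayoff` is the payoff of the models. -/
structure ParamGame (W T E F : Type*) where
  Ω : Set W
  Θ : Set T
  f : W → E
  q : T → F
  modelPayoff : E → F → ℝ

namespace ParamGame

variable {W T E F : Type*}

/-- The payoff of the parameters, `φ(w, θ) = φ̃(f_w, q_θ)`. -/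
def payoff (G : ParamGame W T E F) (w : W) (θ : T) : ℝ :=
  G.modelPayoff (G.f w) (G.q θ)

/-- `D_w`, the largest variation of the payoff when only the first player's parameter changes. -/
def Dw (G : ParamGame W T E F) : ℝ :=
  sSup {x : ℝ | ∃ w ∈ G.Ω, ∃ w' ∈ G.Ω, ∃ θ ∈ G.Θ, x = G.payoff w θ - G.payoff w' θ}

/-- `D_θ`, the largest variation of the payoff when only the second player's parameter changes. -/
def Dθ (G : ParamGame W T E F) : ℝ :=
  sSup {x : ℝ | ∃ w ∈ G.Ω, ∃ θ ∈ G.Θ, ∃ θ' ∈ G.Θ, x = G.payoff w θ - G.payoff w θ'}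

/-- `φ` is `L`-Lipschitz in the parameters: in each of the two parameters, uniformly in the other
one. This is implied by joint `L`-Lipschitz continuity for every usual product metric. -/
def IsLipschitz [PseudoMetricSpace W] [PseudoMetricSpace T] (G : ParamGame W T E F) (L : ℝ) :
    Prop :=
  (∀ w ∈ G.Ω, ∀ w' ∈ G.Ω, ∀ θ ∈ G.Θ, |G.payoff w θ - G.payoff w' θ| ≤ L * dist w w') ∧
  (∀ w ∈ G.Ω, ∀ θ ∈ G.Θ, ∀ θ' ∈ G.Θ, |G.payoff w θ - G.payoff w θ'| ≤ L * dist θ θ')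

variable [AddCommGroup E] [Module ℝ E] [AddCommGroup F] [Module ℝ F]

/-- The convex hull of the set of models of the first player. -/
def hullF (G : ParamGame W T E F) : Set E := convexHull ℝ (G.f '' G.Ω)

/-- The convex hull of the set of models of the second player. -/
def hullG (G : ParamGame W T E F) : Set F := convexHull ℝ (G.q '' G.Θ)

/-- Bilinearity of the payoff on the models of the convexified game: it is compatible with convex
combinations in each argument. The restriction of every bilinear map `E → F → ℝ` has this
property, and so has, for instance, `(D, q) ↦ 𝔼_p D - 𝔼_q D` for a fixed distribution `p`. -/
def IsBilinear (G : ParamGame W T E F) : Prop :=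
  (∀ g₁ ∈ G.hullF, ∀ g₂ ∈ G.hullF, ∀ r ∈ G.hullG, ∀ a b : ℝ, 0 ≤ a → 0 ≤ b → a + b = 1 →
    G.modelPayoff (a • g₁ + b • g₂) r = a * G.modelPayoff g₁ r + b * G.modelPayoff g₂ r) ∧
  (∀ g ∈ G.hullF, ∀ r₁ ∈ G.hullG, ∀ r₂ ∈ G.hullG, ∀ a b : ℝ, 0 ≤ a → 0 ≤ b → a + b = 1 →
    G.modelPayoff g (a • r₁ + b • r₂) = a * G.modelPayoff g r₁ + b * G.modelPayoff g r₂)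

/-- The max-min value of the convexified game. -/
def value (G : ParamGame W T E F) : ℝ :=
  ⨆ g : G.hullF, ⨅ r : G.hullG, G.modelPayoff g r

/-- The min-max value of the convexified game. -/
def upperValue (G : ParamGame W T E F) : ℝ :=
  ⨅ r : G.hullG, ⨆ g : G.hullF, G.modelPayoff g r

/-- `(g, r)` is an `ε`-equilibrium of the convexified game. -/
def IsEpsEquilibrium (G : ParamGame W T E F) (ε : ℝ) (g : E) (r : F) : Prop :=
  g ∈ G.hullF ∧ r ∈ G.hullG ∧
  (∀ r' ∈ G.hullG, G.value - ε ≤ G.modelPayoff g r') ∧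
  (∀ g' ∈ G.hullF, G.modelPayoff g' r ≤ G.value + ε)

/-- The pairs `(K, K')` such that some convex combination of `K` models of the first player,
together with some convex combination of `K'` models of the second player, is an
`ε`-equilibrium. Its least element is `(K_ε^Ω, K_ε^Θ)`. -/
def equilibriumSizes (G : ParamGame W T E F) (ε : ℝ) : Set (ℕ × ℕ) :=
  {K | ∃ l ∈ stdSimplex ℝ (Fin K.1), ∃ l' ∈ stdSimplex ℝ (Fin K.2),
    ∃ w : Fin K.1 → W, ∃ θ : Fin K.2 → T, (∀ k, w k ∈ G.Ω) ∧ (∀ k, θ k ∈ G.Θ) ∧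
      G.IsEpsEquilibrium ε (∑ k, l k • G.f (w k)) (∑ k, l' k • G.q (θ k))}

/-- The pairs `(K, K')` of positive integers such that the uniform average of some `K` models of
the first player, together with the uniform average of some `K'` models of the second player, is
an `ε`-equilibrium. -/
def uniformEquilibriumSizes (G : ParamGame W T E F) (ε : ℝ) : Set (ℕ × ℕ) :=
  {K | 0 < K.1 ∧ 0 < K.2 ∧
    ∃ w : Fin K.1 → W, ∃ θ : Fin K.2 → T, (∀ k, w k ∈ G.Ω) ∧ (∀ k, θ k ∈ G.Θ) ∧
      G.IsEpsEquilibrium ε (∑ k, (1 / (K.1 : ℝ)) • G.f (w k))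
        (∑ k, (1 / (K.2 : ℝ)) • G.q (θ k))}

/-- The convexified game has a value, the least numbers `K_ε^Ω`, `K_ε^Θ` of models whose convex
combinations reach an `ε`-equilibrium exist and are at most `B` and `B'`, and an `ε`-equilibrium
is already reached by uniform averages of at most `B` and `B'` models. -/
def HasEquilibriumBound (G : ParamGame W T E F) (ε B B' : ℝ) : Prop :=
  G.value = G.upperValue ∧
  (∃ K K' : ℕ, IsLeast (G.equilibriumSizes ε) (K, K') ∧ (K : ℝ) ≤ B ∧ (K' : ℝ) ≤ B') ∧
  (∃ K K' : ℕ, (K, K') ∈ G.uniformEquilibriumSizes ε ∧ (K : ℝ) ≤ B ∧ (K' : ℝ) ≤ B')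

end ParamGame

/-- The natural logarithm of the (internal, closed-ball) covering number `𝒩(A, r)`; for totally
bounded `A` and `0 < r` this covering number is finite. -/
def logCoveringNumber {X : Type*} [PseudoMetricSpace X] (A : Set X) (r : ℝ) : ℝ :=
  Real.log ((Metric.coveringNumber r.toNNReal A).toNat : ℝ)

end

/-! An equilibrium is a pair of strategies that each secure the value up to `ε`, and the two
requirements are independent. Once max-min equals min-max, it is therefore enough to find a short
uniform average for the first player; `swap` gives the other one.

Take a nearly optimal mixture of models and draw `K` of them from it. For a fixed `θ`, Hoeffding's
inequality bounds the probability that the average payoff falls `t` below its mean by `exp (-2 K t²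
/ D_w²)`. A union bound handles a finite net `S` of `Θ`, and the Lipschitz condition together with
bilinearity extends the estimate to the whole hull at the cost `L ρ`, where `ρ` is the radius of the
net. A good draw exists as soon as `D_w² log |S| < 2 K (ε - L ρ)²` (`exists_sample_average`,
`hasUniformStrategy_of_net`). In the metric case `L ρ = ε / 2`; in the Euclidean case `S` comes from
a grid of `m ^ p` cubes, and `m` and `K` are tuned together so that rounding to integers respects
the stated constant.

The minimax equality comes from the matrix game on nets of both parameter sets: its saddle point
(`exists_saddle_of_matrix`) gives mixtures that are optimal up to the net error, which is
arbitrarily small. -/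

/-! ### Hoeffding bound and sampling -/

open ProbabilityTheory MeasureTheory in
/-- Hoeffding's lemma for finitely many weights. -/
theorem sum_weights_mul_exp_le {ι : Type*} [Fintype ι] {l : ι → ℝ} (hl : ∀ i, 0 ≤ l i)
    (hl1 : ∑ i, l i = 1) {X : ι → ℝ} {D : ℝ} (hX : ∀ i j, X i - X j ≤ D) (s : ℝ) :
    ∑ i, l i * Real.exp (s * (∑ j, l j * X j - X i)) ≤ Real.exp (s ^ 2 * D ^ 2 / 8) := by
  classical
  have hne : Nonempty ι := by
    by_contra h
    rw [not_nonempty_iff] at h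
    simp at hl1
  let _ : MeasurableSpace ι := ⊤
  have hp : ∑ i, ENNReal.ofReal (l i) = 1 := by
    rw [← ENNReal.ofReal_sum_of_nonneg (fun i _ => hl i), hl1, ENNReal.ofReal_one]
  let P : PMF ι := PMF.ofFintype (fun i => ENNReal.ofReal (l i)) hp
  have hint : ∀ g : ι → ℝ, ∫ i, g i ∂P.toMeasure = ∑ i, l i * g i := by
    intro g
    rw [PMF.integral_eq_sum]
    refine Finset.sum_congr rfl fun i _ => ?_
    simp [P, ENNReal.toReal_ofReal (hl i)]
  set m := ∑ j, l j * X j with hm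
  -- The largest `X i₀` gives the left end of an interval of length `D` that contains every centred
  -- value.
  obtain ⟨i₀, hi₀⟩ := Finite.exists_max X
  have hb : ∀ᵐ i ∂P.toMeasure, m - X i ∈ Set.Icc (m - X i₀) (m - X i₀ + D) :=
    Filter.Eventually.of_forall fun i => ⟨by linarith [hi₀ i], by linarith [hX i₀ i]⟩
  have h0 : ∫ i, (m - X i) ∂P.toMeasure = 0 := by
    rw [hint]
    simp only [mul_sub, Finset.sum_sub_distrib, ← Finset.sum_mul, hl1, ← hm]
    ring
  have key := (hasSubgaussianMGF_of_mem_Icc_of_integral_eq_zero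
    (measurable_from_top.aemeasurable) hb h0).mgf_le s
  rw [mgf, hint] at key
  refine key.trans (Real.exp_le_exp.2 (le_of_eq ?_))
  simp only [NNReal.coe_pow, NNReal.coe_div, coe_nnnorm, Real.norm_eq_abs, add_sub_cancel_left,
    NNReal.coe_ofNat, div_pow, sq_abs]
  ring

/-- Sampling from a convex combination: the average of some `K` members of a family `X` exceeds
the mean minus `t` simultaneously on a finite set `S`. -/
theorem exists_sample_average {ι A : Type*} [Fintype ι] {l : ι → ℝ} (hl : ∀ i, 0 ≤ l i)
    (hl1 : ∑ i, l i = 1) {X : ι → A → ℝ} {S : Finset A} {D t : ℝ}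
    (hX : ∀ a ∈ S, ∀ i j, X i a - X j a ≤ D) (hD : 0 < D) (ht : 0 < t) {K : ℕ}
    (hK : D ^ 2 * Real.log S.card < 2 * K * t ^ 2) :
    ∃ σ : Fin K → ι, ∀ a ∈ S, K * (∑ i, l i * X i a - t) ≤ ∑ k, X (σ k) a := by
  -- This `s` minimizes the Chernoff exponent `s ^ 2 * D ^ 2 / 8 - s * t`, with minimum `-2 * t ^ 2
  -- / D ^ 2`.
  set s := 4 * t / D ^ 2 with hs
  have hs0 : 0 < s := by positivity
  -- The union bound, derandomized: the sum over `S` of exponential deviations is a potential.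
  -- Averaged over the next draw it grows by at most the Hoeffding factor, so some draw does no
  -- worse than the average.
  have step : ∀ n : ℕ, ∃ σ : Fin n → ι,
      ∑ a ∈ S, Real.exp (s * ∑ k, (∑ i, l i * X i a - X (σ k) a)) ≤
        S.card * Real.exp (s ^ 2 * D ^ 2 / 8) ^ n := by
    intro n
    induction n with
    | zero => exact ⟨Fin.elim0, by simp⟩
    | succ n ih =>
      obtain ⟨σ, hσ⟩ := ih
      set c : A → ℝ := fun a => Real.exp (s * ∑ k, (∑ i, l i * X i a - X (σ k) a)) with hc
      set e := Real.exp (s ^ 2 * D ^ 2 / 8) with he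
      have havg : ∑ j, l j * ∑ a ∈ S, c a * Real.exp (s * (∑ i, l i * X i a - X j a)) ≤
          ∑ j, l j * (S.card * e ^ (n + 1)) := by
        rw [← Finset.sum_mul, hl1, one_mul]
        calc _ = ∑ a ∈ S, c a * ∑ j, l j * Real.exp (s * (∑ i, l i * X i a - X j a)) := by
              simp only [Finset.mul_sum]
              rw [Finset.sum_comm]
              exact Finset.sum_congr rfl fun a _ => Finset.sum_congr rfl fun j _ => by ring
          _ ≤ ∑ a ∈ S, c a * e := Finset.sum_le_sum fun a ha =>
              mul_le_mul_of_nonneg_left (sum_weights_mul_exp_le hl hl1 (hX a ha) s)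
                (Real.exp_pos _).le
          _ ≤ (S.card * e ^ n) * e := by
              rw [← Finset.sum_mul]
              exact mul_le_mul_of_nonneg_right hσ (Real.exp_pos _).le
          _ = _ := by ring
      have : ∃ j, ∑ a ∈ S, c a * Real.exp (s * (∑ i, l i * X i a - X j a)) ≤
          S.card * e ^ (n + 1) := by
        by_contra! hcon
        obtain ⟨j₀, -, hj₀⟩ : ∃ j ∈ Finset.univ, 0 < l j := by
          by_contra! h
          have := Finset.sum_nonpos h
          linarith
        exact absurd havg (not_le.2 (Finset.sum_lt_sum
          (fun j _ => mul_le_mul_of_nonneg_left (hcon j).le (hl j))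
          ⟨j₀, Finset.mem_univ _, mul_lt_mul_of_pos_left (hcon j₀) hj₀⟩))
      obtain ⟨j, hj⟩ := this
      refine ⟨Fin.snoc σ j, le_trans (le_of_eq ?_) hj⟩
      refine Finset.sum_congr rfl fun a _ => ?_
      rw [Fin.sum_univ_castSucc]
      simp only [Fin.snoc_castSucc, Fin.snoc_last, hc]
      rw [mul_add, Real.exp_add]
  obtain ⟨σ, hσ⟩ := step K
  refine ⟨σ, fun a ha => ?_⟩
  have hcard : (0 : ℝ) < S.card := by exact_mod_cast Finset.card_pos.2 ⟨a, ha⟩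
  have h1 : Real.exp (s * ∑ k, (∑ i, l i * X i a - X (σ k) a)) ≤
      Real.exp (Real.log S.card + K * (s ^ 2 * D ^ 2 / 8)) := by
    rw [Real.exp_add, Real.exp_log hcard, Real.exp_nat_mul]
    exact (Finset.single_le_sum (f := fun a =>
      Real.exp (s * ∑ k, (∑ i, l i * X i a - X (σ k) a)))
      (fun _ _ => (Real.exp_pos _).le) ha).trans hσ
  rw [Real.exp_le_exp, Finset.sum_sub_distrib] at h1
  simp only [Finset.sum_const, Finset.card_univ, Fintype.card_fin, nsmul_eq_mul] at h1
  have h2 : Real.log S.card + K * (s ^ 2 * D ^ 2 / 8) ≤ s * (K * t) := by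
    have e1 : K * (s ^ 2 * D ^ 2 / 8) = 2 * K * t ^ 2 / D ^ 2 := by rw [hs]; field_simp; ring
    have e2 : s * (K * t) = 2 * (2 * K * t ^ 2 / D ^ 2) := by rw [hs]; field_simp; ring
    have e3 : Real.log S.card ≤ 2 * K * t ^ 2 / D ^ 2 := by
      rw [le_div_iff₀ (by positivity)]; linarith
    linarith
  have h3 := le_of_mul_le_mul_left (h1.trans h2) hs0
  linarith

/-! ### Grid nets in Euclidean space -/

/-- A nonempty subset of the Euclidean ball of radius `R` in dimension `p` is covered by `m ^ p`
of its points, up to the diameter of a cube of side `2 * R / m`. -/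
theorem exists_net_of_norm_le {p : ℕ} {A : Set (EuclideanSpace ℝ (Fin p))} (hA : A.Nonempty)
    {R : ℝ} (hR : ∀ x ∈ A, ‖x‖ ≤ R) {m : ℕ} (hm : 0 < m) :
    ∃ S : Finset (EuclideanSpace ℝ (Fin p)), (∀ x ∈ S, x ∈ A) ∧ S.card ≤ m ^ p ∧
      ∀ x ∈ A, ∃ y ∈ S, dist x y ≤ 2 * R * √p / m := by
  classical
  obtain ⟨a₀, ha₀⟩ := hA
  have hR0 : 0 ≤ R := (norm_nonneg _).trans (hR _ ha₀)
  have hm' : (0 : ℝ) < m := by exact_mod_cast hm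
  set h := 2 * R / m with hh
  have hmh : m * h = 2 * R := by rw [hh]; field_simp
  -- The cell index is a ceiling minus one, so that `x = R` falls in the last cell; `x = -R` is put
  -- in cell `0` separately.
  have cell : ∀ x : ℝ, |x| ≤ R → ∃ j : Fin m, -R + j * h ≤ x ∧ x ≤ -R + (j + 1) * h := by
    intro x hx
    obtain ⟨hx1, hx2⟩ := abs_le.1 hx
    rcases hR0.eq_or_lt with h0 | h0
    · have : h = 0 := by rw [hh, ← h0]; simp
      exact ⟨⟨0, hm⟩, by simp [this, hx1], by simp [this]; linarith⟩
    · have hpos : 0 < h := by positivity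
      have hle : (⌈(x + R) / h⌉₊ : ℕ) ≤ m := by
        rw [Nat.ceil_le, div_le_iff₀ hpos]; linarith
      rcases Nat.eq_zero_or_pos ⌈(x + R) / h⌉₊ with hz | hz
      · rw [Nat.ceil_eq_zero, div_le_iff₀ hpos] at hz
        exact ⟨⟨0, hm⟩, by simp [hx1], by simp; linarith⟩
      · obtain ⟨n, hn⟩ := Nat.exists_eq_add_of_lt hz
        rw [zero_add] at hn
        have h1 : (x + R) / h ≤ (n + 1 : ℕ) := by rw [← hn]; exact Nat.le_ceil _
        have h2 : (n : ℝ) < (x + R) / h := by rw [← Nat.lt_ceil]; omega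
        rw [div_le_iff₀ hpos] at h1
        rw [lt_div_iff₀ hpos] at h2
        push_cast at h1
        exact ⟨⟨n, by omega⟩, by simp; linarith, by simp; linarith⟩
  have hcoord : ∀ x ∈ A, ∀ i, |x i| ≤ R := fun x hx i => (PiLp.norm_apply_le x i).trans (hR x hx)
  have : ∀ x : EuclideanSpace ℝ (Fin p), ∃ c : Fin p → Fin m, x ∈ A →
      ∀ i, -R + (c i : ℕ) * h ≤ x i ∧ x i ≤ -R + ((c i : ℕ) + 1) * h := by
    intro x
    by_cases hx : x ∈ A
    · choose c hc using fun i => cell (x i) (hcoord x hx i)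
      exact ⟨c, fun _ => hc⟩
    · exact ⟨fun _ => ⟨0, hm⟩, fun h => absurd h hx⟩
  choose c hc using this
  -- Each occupied cube is represented by one of its points in `A`, so the centres are internal;
  -- empty cubes get the dummy `a₀`.
  have : ∀ k : Fin p → Fin m, ∃ y ∈ A, ∀ x ∈ A, c x = k → c y = k := by
    intro k
    by_cases hk : ∃ y ∈ A, c y = k
    · obtain ⟨y, hy, hyk⟩ := hk
      exact ⟨y, hy, fun _ _ _ => hyk⟩
    · exact ⟨a₀, ha₀, fun x hx hxk => absurd ⟨x, hx, hxk⟩ hk⟩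
  choose rep hrepA hrep using this
  refine ⟨Finset.univ.image rep, by simpa using hrepA,
    Finset.card_image_le.trans (by simp), fun x hx =>
      ⟨rep (c x), Finset.mem_image_of_mem _ (Finset.mem_univ _), ?_⟩⟩
  set y := rep (c x)
  have hcy : c y = c x := hrep _ x hx rfl
  have hdist : ∀ i, dist (x i) (y i) ^ 2 ≤ h ^ 2 := by
    intro i
    obtain ⟨h1, h2⟩ := hc x hx i
    obtain ⟨h3, h4⟩ := hc y (hrepA _) i
    rw [hcy] at h3 h4
    have : |x i - y i| ≤ h := abs_le.2 ⟨by linarith, by linarith⟩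
    rw [Real.dist_eq]
    exact pow_le_pow_left₀ (abs_nonneg _) this 2
  rw [EuclideanSpace.dist_eq]
  calc √(∑ i, dist (x i) (y i) ^ 2) ≤ √(p * h ^ 2) := by
        refine Real.sqrt_le_sqrt ((Finset.sum_le_sum fun i _ => hdist i).trans ?_)
        simp
    _ = 2 * R * √p / m := by
        rw [Real.sqrt_mul (by positivity), Real.sqrt_sq (by positivity), hh]; ring

/-! ### Integer choice of sample size and grid size -/

/-- An integer above `x` and at most `max 1 B`. -/
theorem exists_nat_gt_and_le_max {x B : ℝ} (hx : 0 ≤ x) (hB : x + 1 ≤ B ∨ x < 1) :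
    ∃ K : ℕ, 0 < K ∧ x < K ∧ (K : ℝ) ≤ max 1 B := by
  refine ⟨⌊x⌋₊ + 1, by omega, by exact_mod_cast Nat.lt_floor_add_one x, ?_⟩
  rcases hB with h | h
  · refine le_max_of_le_right ?_
    push_cast
    linarith [Nat.floor_le hx]
  · rw [Nat.floor_eq_zero.2 h]
    simp

/-- Sample size and grid size for normalized constants. -/
theorem exists_sample_and_grid_size {p : ℕ} (hp : 0 < p) {c v : ℝ} (hc : 1 < c) (hv0 : 0 ≤ v)
    (hcv : 4 * c * p ≤ v ^ 2) :
    ∃ K m : ℕ, 0 < K ∧ 0 < m ∧ (K : ℝ) ≤ max 1 (4 * c * p * Real.log v) ∧ v / (2 * m) < 1 ∧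
      c * (p * Real.log m) < 2 * K * (1 - v / (2 * m)) ^ 2 := by
  have hp1 : (1 : ℝ) ≤ p := by exact_mod_cast hp
  have hv2 : 2 < v := by
    have : (4 : ℝ) < 4 * c * p := by nlinarith
    nlinarith
  have hvpos : 0 < v := by linarith
  have hcpos : 0 < c := by linarith
  -- Here `v / (2 * m)` is the share of `ε` lost on the net. For `m ≥ v` it is at most `1 / 2`, so
  -- any `K` above `2 * c * p * log m` suffices. An admissible integer exists once the gap up to `4
  -- * c * p * log v`, which is `2 * c * p * log (v ^ 2 / m)`, is at least `1`.
  have grid : ∀ m : ℕ, 0 < m → v ≤ m → 1 ≤ 2 * c * p * Real.log (v ^ 2 / m) →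
      ∃ K m : ℕ, 0 < K ∧ 0 < m ∧ (K : ℝ) ≤ max 1 (4 * c * p * Real.log v) ∧ v / (2 * m) < 1 ∧
      c * (p * Real.log m) < 2 * K * (1 - v / (2 * m)) ^ 2 := by
    intro m hm hvm hlog
    have hm0 : (0 : ℝ) < m := by exact_mod_cast hm
    rw [Real.log_div (by positivity) (by positivity), Real.log_pow] at hlog
    push_cast at hlog
    have hlm : 0 ≤ Real.log m := Real.log_nonneg (by linarith)
    obtain ⟨K, hK0, hxK, hKB⟩ := exists_nat_gt_and_le_max (x := 2 * c * p * Real.log m)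
      (B := 4 * c * p * Real.log v) (by positivity) (Or.inl (by linarith))
    have hhalf : v / (2 * m) ≤ 1 / 2 := by
      rw [div_le_div_iff₀ (by positivity) (by norm_num)]; linarith
    refine ⟨K, m, hK0, hm, hKB, by linarith, ?_⟩
    have : (1 / 4 : ℝ) ≤ (1 - v / (2 * m)) ^ 2 := by nlinarith
    have hK' : (0 : ℝ) < K := by exact_mod_cast hK0
    nlinarith
  have hexp1 := Real.exp_one_lt_d9
  have hexp_half : Real.exp (1 / 2) ≤ 1.6488 := by
    refine le_of_pow_le_pow_left₀ (n := 2) (by norm_num) (by norm_num) ?_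
    rw [← Real.exp_nat_mul]; norm_num at hexp1 ⊢; linarith
  have hexp_quarter : Real.exp (1 / 4) ≤ 1.3 := by
    refine le_of_pow_le_pow_left₀ (n := 4) (by norm_num) (by norm_num) ?_
    rw [← Real.exp_nat_mul]; norm_num at hexp1 ⊢; linarith
  have hceil := Nat.ceil_lt_add_one hv0
  have hceil' := Nat.le_ceil v
  rcases Nat.lt_or_ge 1 p with hp2 | hp2
  · have hp2' : (2 : ℝ) ≤ p := by exact_mod_cast hp2
    refine grid ⌈v⌉₊ (Nat.ceil_pos.2 hvpos) hceil' ?_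
    have hm0 : (0 : ℝ) < ⌈v⌉₊ := by linarith
    -- For `p ≥ 2` the factor `2 * c * p` is at least `4`, so a logarithm of `1 / 4` is enough; `v >
    -- 2` leaves that much after rounding up.
    have : 1 / 4 ≤ Real.log (v ^ 2 / ⌈v⌉₊) := by
      rw [Real.le_log_iff_exp_le (by positivity)]
      refine hexp_quarter.trans ?_
      rw [le_div_iff₀ hm0]
      nlinarith
    have : 4 ≤ 2 * c * p := by nlinarith
    nlinarith
  · obtain rfl : p = 1 := by omega
    simp only [Nat.cast_one] at grid hcv ⊢
    -- For `p = 1` only `2 * c > 2` is available, so the logarithm must reach `1 / 2`. With `m =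
    -- ⌈v⌉₊ = 3` this fails when `v` is close to `2`.
    have fine : ∀ m : ℕ, 0 < m → v ≤ m → 1.6488 * m ≤ v ^ 2 →
        1 ≤ 2 * c * 1 * Real.log (v ^ 2 / m) := by
      intro m hm _ hvm
      have hm0 : (0 : ℝ) < m := by exact_mod_cast hm
      have : 1 / 2 ≤ Real.log (v ^ 2 / m) := by
        rw [Real.le_log_iff_exp_le (by positivity)]
        refine hexp_half.trans ?_
        rw [le_div_iff₀ hm0]
        exact hvm
      nlinarith
    -- Near `v = 2` the rounding gap is too small, and explicit values `K = m = 2`, then `K = m =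
    -- 3`, are checked directly with `c ≤ v ^ 2 / 4`.
    rcases lt_or_ge v 2.15 with h1 | h1
    · refine ⟨2, 2, by norm_num, by norm_num, le_max_of_le_right ?_, ?_, ?_⟩
      · have : Real.log 2 ≤ Real.log v := Real.log_le_log (by norm_num) hv2.le
        have := Real.log_two_gt_d9
        push_cast
        nlinarith
      · push_cast; linarith
      · have := Real.log_two_lt_d9
        have h2 := Real.log_two_gt_d9
        push_cast
        have : c * Real.log 2 ≤ v ^ 2 / 4 * 0.6931471808 :=
          mul_le_mul (by linarith) this.le (by linarith) (by positivity)
        nlinarith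
    rcases lt_or_ge v 2.25 with h3 | h3
    · refine ⟨3, 3, by norm_num, by norm_num, le_max_of_le_right ?_, ?_, ?_⟩
      · have : 3 / 4 ≤ Real.log v := by
          rw [Real.le_log_iff_exp_le hvpos]
          refine le_trans ?_ h1
          refine le_of_pow_le_pow_left₀ (n := 4) (by norm_num) (by norm_num) ?_
          rw [← Real.exp_nat_mul]
          have : Real.exp ((4 : ℕ) * (3 / 4)) = Real.exp 1 ^ 3 := by
            rw [← Real.exp_nat_mul]; norm_num
          rw [this]
          exact (pow_le_pow_left₀ (Real.exp_pos _).le hexp1.le 3).trans (by norm_num)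
        push_cast
        nlinarith
      · push_cast; linarith
      · have : Real.log 3 ≤ 7 / 6 := by
          rw [Real.log_le_iff_le_exp (by norm_num)]
          refine le_of_pow_le_pow_left₀ (n := 6) (by norm_num) (Real.exp_pos _).le ?_
          rw [← Real.exp_nat_mul]
          have : Real.exp ((6 : ℕ) * (7 / 6)) = Real.exp 1 ^ 7 := by
            rw [← Real.exp_nat_mul]; norm_num
          rw [this]
          exact le_trans (by norm_num)
            (pow_le_pow_left₀ (by norm_num) Real.exp_one_gt_d9.le 7)
        have h4 : 0 ≤ Real.log 3 := Real.log_nonneg (by norm_num)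
        push_cast
        have : c * Real.log 3 ≤ v ^ 2 / 4 * (7 / 6) :=
          mul_le_mul (by linarith) this h4 (by positivity)
        nlinarith
    rcases le_or_gt v 3 with h4 | h4
    · have h4' : v ≤ (3 : ℕ) := by exact_mod_cast h4
      exact grid 3 (by norm_num) h4' (fine 3 (by norm_num) h4' (by push_cast; nlinarith))
    · exact grid ⌈v⌉₊ (Nat.ceil_pos.2 hvpos) hceil'
        (fine _ (Nat.ceil_pos.2 hvpos) hceil' (by nlinarith))

/-! ### Finite minimax theorem -/

/-- Bilinear payoffs on simplices have saddle points. -/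
theorem exists_saddle_of_matrix {I J : Type} [Fintype I] [Fintype J] [Nonempty I] [Nonempty J]
    (A : I → J → ℝ) :
    ∃ x ∈ stdSimplex ℝ I, ∃ y ∈ stdSimplex ℝ J, ∃ v : ℝ,
      (∀ j, v ≤ ∑ i, x i * A i j) ∧ ∀ i, ∑ j, y j * A i j ≤ v := by
  classical
  have lin₁ : ∀ y : I → ℝ, IsLinearMap ℝ fun x : J → ℝ => ∑ i, ∑ j, y i * x j * A i j := fun y =>
    ⟨fun a b => by simp only [Pi.add_apply, mul_add, add_mul, Finset.sum_add_distrib],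
      fun c a => by
        simp only [Pi.smul_apply, smul_eq_mul, Finset.mul_sum]
        exact Finset.sum_congr rfl fun i _ => Finset.sum_congr rfl fun j _ => by ring⟩
  have lin₂ : ∀ x : J → ℝ, IsLinearMap ℝ fun y : I → ℝ => ∑ i, ∑ j, y i * x j * A i j := fun x =>
    ⟨fun a b => by simp only [Pi.add_apply, add_mul, Finset.sum_add_distrib],
      fun c a => by
        simp only [Pi.smul_apply, smul_eq_mul, Finset.mul_sum]
        exact Finset.sum_congr rfl fun i _ => Finset.sum_congr rfl fun j _ => by ring⟩
  obtain ⟨y, hy, x, hx, h⟩ := Sion.exists_isSaddlePointOn (X := stdSimplex ℝ J)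
    (Y := stdSimplex ℝ I) (f := fun y x => ∑ i, ∑ j, x i * y j * A i j)
    ⟨_, single_mem_stdSimplex ℝ (Classical.arbitrary J)⟩ (convex_stdSimplex ℝ J)
    (isCompact_stdSimplex ℝ J)
    (fun x _ => (Continuous.lowerSemicontinuous (by fun_prop)).lowerSemicontinuousOn _)
    (fun x _ => (((lin₁ x).mk').convexOn (convex_stdSimplex ℝ J)).quasiconvexOn)
    (convex_stdSimplex ℝ I) ⟨_, single_mem_stdSimplex ℝ (Classical.arbitrary I)⟩
    (isCompact_stdSimplex ℝ I)
    (fun y _ => (Continuous.upperSemicontinuous (by fun_prop)).upperSemicontinuousOn _)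
    (fun y _ => (((lin₂ y).mk').concaveOn (convex_stdSimplex ℝ I)).quasiconcaveOn)
  refine ⟨x, hx, y, hy, ∑ i, ∑ j, x i * y j * A i j, fun j => ?_, fun i => ?_⟩
  -- Testing the saddle inequality at the vertices of either simplex gives the bounds against pure
  -- strategies.
  · have := h _ (single_mem_stdSimplex ℝ j) x hx
    simpa [Pi.single_apply, mul_ite, ite_mul] using this
  · have := h y hy _ (single_mem_stdSimplex ℝ i)
    simpa [Pi.single_apply, mul_ite, ite_mul] using this

/-! ### Symmetry between the players and bounded payoffs -/

namespace ParamGame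

/-- The same game seen by the second player, who maximizes the negated payoff. -/
def swap {W T E F : Type*} (G : ParamGame W T E F) : ParamGame T W F E :=
  ⟨G.Θ, G.Ω, G.q, G.f, fun r g => -G.modelPayoff g r⟩

theorem swap_payoff {W T E F : Type*} (G : ParamGame W T E F) (w : W) (θ : T) :
    G.swap.payoff θ w = -G.payoff w θ := rfl

theorem swap_Dw {W T E F : Type*} (G : ParamGame W T E F) : G.swap.Dw = G.Dθ := by
  unfold Dw Dθ
  congr 1
  ext x
  constructor
  · rintro ⟨θ, hθ, θ', hθ', w, hw, rfl⟩
    exact ⟨w, hw, θ', hθ', θ, hθ, by rw [swap_payoff, swap_payoff]; ring⟩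
  · rintro ⟨w, hw, θ', hθ', θ, hθ, rfl⟩
    exact ⟨θ, hθ, θ', hθ', w, hw, by rw [swap_payoff, swap_payoff]; ring⟩

/-- The payoff is bounded on pairs of models. -/
def IsBoundedPayoff {W T E F : Type*} (G : ParamGame W T E F) : Prop :=
  ∃ M, ∀ w ∈ G.Ω, ∀ θ ∈ G.Θ, |G.payoff w θ| ≤ M

theorem IsBoundedPayoff.swap {W T E F : Type*} {G : ParamGame W T E F}
    (h : G.IsBoundedPayoff) : G.swap.IsBoundedPayoff := by
  obtain ⟨M, hM⟩ := h
  exact ⟨M, fun θ hθ w hw => by rw [swap_payoff, abs_neg]; exact hM w hw θ hθ⟩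

theorem IsBoundedPayoff.sub_le_Dw {W T E F : Type*} {G : ParamGame W T E F}
    (h : G.IsBoundedPayoff) {w w' : W} {θ : T} (hw : w ∈ G.Ω) (hw' : w' ∈ G.Ω) (hθ : θ ∈ G.Θ) :
    G.payoff w θ - G.payoff w' θ ≤ G.Dw := by
  obtain ⟨M, hM⟩ := h
  refine le_csSup ⟨2 * M, ?_⟩ ⟨w, hw, w', hw', θ, hθ, rfl⟩
  rintro _ ⟨w, hw, w', hw', θ, hθ, rfl⟩
  linarith [(abs_le.1 (hM w hw θ hθ)).2, (abs_le.1 (hM w' hw' θ hθ)).1]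

theorem f_mem_hullF {W T E F : Type*} [AddCommGroup E] [Module ℝ E] {G : ParamGame W T E F}
    {w : W} (hw : w ∈ G.Ω) : G.f w ∈ G.hullF :=
  subset_convexHull ℝ _ (Set.mem_image_of_mem _ hw)

theorem q_mem_hullG {W T E F : Type*} [AddCommGroup F] [Module ℝ F] {G : ParamGame W T E F}
    {θ : T} (hθ : θ ∈ G.Θ) : G.q θ ∈ G.hullG :=
  subset_convexHull ℝ _ (Set.mem_image_of_mem _ hθ)

theorem exists_weights_of_mem_hullF {W T E F : Type*} [AddCommGroup E] [Module ℝ E]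
    {G : ParamGame W T E F} {g : E} (hg : g ∈ G.hullF) :
    ∃ (ι : Type) (_ : Fintype ι) (l : ι → ℝ) (w : ι → W), (∀ i, 0 ≤ l i) ∧ ∑ i, l i = 1 ∧
      (∀ i, w i ∈ G.Ω) ∧ g = ∑ i, l i • G.f (w i) := by
  obtain ⟨ι, _, l, z, hl, hl1, hz, rfl⟩ := mem_convexHull_iff_exists_fintype.1 hg
  choose w hw hwz using hz
  exact ⟨ι, _, l, w, hl, hl1, hw, by simp [hwz]⟩

theorem sum_mem_hullF {W T E F : Type*} [AddCommGroup E] [Module ℝ E] {G : ParamGame W T E F}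
    {ι : Type*} [Fintype ι] {l : ι → ℝ} (hl : ∀ i, 0 ≤ l i)
    (hl1 : ∑ i, l i = 1) {w : ι → W} (hw : ∀ i, w i ∈ G.Ω) :
    ∑ i, l i • G.f (w i) ∈ G.hullF :=
  (convex_convexHull ℝ _).sum_mem (fun i _ => hl i) hl1 fun i _ => f_mem_hullF (hw i)

/-! ### Values and strategies of the convexified game -/

section Models

variable {W T E F : Type*} [AddCommGroup E] [Module ℝ E] [AddCommGroup F] [Module ℝ F]
  {G : ParamGame W T E F}

theorem IsBilinear.swap (hB : G.IsBilinear) : G.swap.IsBilinear := by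
  refine ⟨fun g₁ h₁ g₂ h₂ r hr a b ha hb hab => ?_, fun g hg r₁ h₁ r₂ h₂ a b ha hb hab => ?_⟩
  · have := hB.2 r hr g₁ h₁ g₂ h₂ a b ha hb hab
    simp only [ParamGame.swap]
    linarith
  · have := hB.1 r₁ h₁ r₂ h₂ g hg a b ha hb hab
    simp only [ParamGame.swap]
    linarith

/-- Negation exchanges real suprema and infima even where they take default values, so no
boundedness enters. -/
theorem swap_value : G.swap.value = -G.upperValue := by
  unfold value upperValue
  rw [iSup, iInf, ← Real.sSup_neg]
  congr 1
  ext x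
  simp only [Set.mem_range, Set.mem_neg]
  have : ∀ r : F, ⨅ g : G.hullF, -G.modelPayoff g r = -⨆ g : G.hullF, G.modelPayoff g r := by
    intro r
    rw [iSup, iInf, ← Real.sInf_neg]
    congr 1
    ext y
    simp [neg_eq_iff_eq_neg]
  constructor
  · rintro ⟨r, hr⟩
    exact ⟨r, by rw [← hr]; erw [this]; simp⟩
  · rintro ⟨r, hr⟩
    exact ⟨r, by erw [this]; rw [hr]; simp⟩

theorem IsBilinear.convexOn (hB : G.IsBilinear) {r : F} (hr : r ∈ G.hullG) :
    ConvexOn ℝ G.hullF fun g => G.modelPayoff g r :=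
  ⟨convex_convexHull ℝ _, fun _ h₁ _ h₂ _ _ ha hb hab =>
    (hB.1 _ h₁ _ h₂ r hr _ _ ha hb hab).le⟩

theorem IsBilinear.concaveOn (hB : G.IsBilinear) {r : F} (hr : r ∈ G.hullG) :
    ConcaveOn ℝ G.hullF fun g => G.modelPayoff g r :=
  ⟨convex_convexHull ℝ _, fun _ h₁ _ h₂ _ _ ha hb hab =>
    (hB.1 _ h₁ _ h₂ r hr _ _ ha hb hab).ge⟩

theorem IsBilinear.modelPayoff_sum (hB : G.IsBilinear) {r : F} (hr : r ∈ G.hullG) {ι : Type*}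
    [Fintype ι] {l : ι → ℝ} (hl : ∀ i, 0 ≤ l i) (hl1 : ∑ i, l i = 1) {w : ι → W}
    (hw : ∀ i, w i ∈ G.Ω) :
    G.modelPayoff (∑ i, l i • G.f (w i)) r = ∑ i, l i * G.modelPayoff (G.f (w i)) r :=
  le_antisymm
    ((hB.convexOn hr).map_sum_le (fun i _ => hl i) hl1 fun i _ => f_mem_hullF (hw i))
    ((hB.concaveOn hr).le_map_sum (fun i _ => hl i) hl1 fun i _ => f_mem_hullF (hw i))

/-- A superlevel set of a concave function is convex, so once it contains the models it contains
their hull. -/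
theorem IsBilinear.le_modelPayoff (hB : G.IsBilinear) {r : F} (hr : r ∈ G.hullG) {c : ℝ}
    (h : ∀ w ∈ G.Ω, c ≤ G.modelPayoff (G.f w) r) {g : E} (hg : g ∈ G.hullF) :
    c ≤ G.modelPayoff g r := by
  have := convexHull_min (s := G.f '' G.Ω) (fun _ hx => ?_) ((hB.concaveOn hr).convex_ge c)
  · exact (this hg).2
  · obtain ⟨w, hw, rfl⟩ := hx
    exact ⟨f_mem_hullF hw, h w hw⟩

theorem IsBilinear.modelPayoff_le (hB : G.IsBilinear) {r : F} (hr : r ∈ G.hullG) {c : ℝ}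
    (h : ∀ w ∈ G.Ω, G.modelPayoff (G.f w) r ≤ c) {g : E} (hg : g ∈ G.hullF) :
    G.modelPayoff g r ≤ c := by
  have := convexHull_min (s := G.f '' G.Ω) (fun _ hx => ?_) ((hB.convexOn hr).convex_le c)
  · exact (this hg).2
  · obtain ⟨w, hw, rfl⟩ := hx
    exact ⟨f_mem_hullF hw, h w hw⟩

theorem IsBilinear.le_modelPayoff_right (hB : G.IsBilinear) {g : E} (hg : g ∈ G.hullF) {c : ℝ}
    (h : ∀ θ ∈ G.Θ, c ≤ G.modelPayoff g (G.q θ)) {r : F} (hr : r ∈ G.hullG) :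
    c ≤ G.modelPayoff g r := by
  have := hB.swap.modelPayoff_le (r := g) hg (c := -c)
    (fun θ hθ => neg_le_neg (h θ hθ)) (g := r) hr
  exact neg_le_neg_iff.1 this

theorem IsBoundedPayoff.exists_abs_le (h : G.IsBoundedPayoff) (hB : G.IsBilinear) :
    ∃ M, ∀ g ∈ G.hullF, ∀ r ∈ G.hullG, |G.modelPayoff g r| ≤ M := by
  obtain ⟨M, hM⟩ := h
  refine ⟨M, fun g hg r hr => abs_le.2 ⟨?_, ?_⟩⟩
  · exact hB.le_modelPayoff_right hg (fun θ hθ => hB.le_modelPayoff (q_mem_hullG hθ)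
      (fun w hw => (abs_le.1 (hM w hw θ hθ)).1) hg) hr
  · refine hB.modelPayoff_le hr (fun w hw => ?_) hg
    have := hB.swap.le_modelPayoff (r := G.f w) (f_mem_hullF hw) (c := -M)
      (fun θ hθ => neg_le_neg (abs_le.1 (hM w hw θ hθ)).2) (g := r) hr
    exact neg_le_neg_iff.1 this

/-- Boundedness ensures that the `⨆` and `⨅` in `value` are true bounds and not default values. -/
theorem le_value (hB : G.IsBilinear) (hb : G.IsBoundedPayoff) (hΘ : G.Θ.Nonempty) {c : ℝ} {g : E}
    (hg : g ∈ G.hullF) (h : ∀ r ∈ G.hullG, c ≤ G.modelPayoff g r) : c ≤ G.value := by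
  obtain ⟨M, hM⟩ := hb.exists_abs_le hB
  obtain ⟨θ, hθ⟩ := hΘ
  have : Nonempty G.hullG := ⟨⟨_, q_mem_hullG hθ⟩⟩
  refine le_ciSup_of_le ⟨M, ?_⟩ (⟨g, hg⟩ : G.hullF) (le_ciInf fun r => h r r.2)
  rintro _ ⟨g', rfl⟩
  refine (ciInf_le ⟨-M, ?_⟩ (⟨_, q_mem_hullG hθ⟩ : G.hullG)).trans
    (abs_le.1 (hM _ g'.2 _ (q_mem_hullG hθ))).2
  rintro _ ⟨r, rfl⟩
  exact (abs_le.1 (hM _ g'.2 _ r.2)).1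

theorem exists_value_sub_le (hB : G.IsBilinear) (hb : G.IsBoundedPayoff) (hΩ : G.Ω.Nonempty)
    {δ : ℝ} (hδ : 0 < δ) : ∃ g ∈ G.hullF, ∀ r ∈ G.hullG, G.value - δ ≤ G.modelPayoff g r := by
  obtain ⟨M, hM⟩ := hb.exists_abs_le hB
  obtain ⟨w, hw⟩ := hΩ
  have : Nonempty G.hullF := ⟨⟨_, f_mem_hullF hw⟩⟩
  obtain ⟨g, hg⟩ := exists_lt_of_lt_ciSup (show G.value - δ < G.value by linarith)
  refine ⟨g, g.2, fun r hr => hg.le.trans (ciInf_le ⟨-M, ?_⟩ (⟨r, hr⟩ : G.hullG))⟩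
  rintro _ ⟨r, rfl⟩
  exact (abs_le.1 (hM _ g.2 _ r.2)).1

/-- Strategies of both players that are optimal up to `δ / 2` are played against each other. -/
theorem value_le_upperValue (hB : G.IsBilinear) (hb : G.IsBoundedPayoff) (hΩ : G.Ω.Nonempty)
    (hΘ : G.Θ.Nonempty) : G.value ≤ G.upperValue := by
  refine le_of_forall_pos_le_add fun δ hδ => ?_
  obtain ⟨g, hg, hgr⟩ := exists_value_sub_le hB hb hΩ (half_pos hδ)
  obtain ⟨r, hr, hrg⟩ := exists_value_sub_le hB.swap hb.swap hΘ (half_pos hδ)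
  have h1 := hgr r hr
  have h2 : G.swap.value - δ / 2 ≤ -G.modelPayoff g r := hrg g hg
  rw [swap_value] at h2
  linarith

/-- The uniform averages of `K` models of the first player contain one that secures the value of
the game up to `ε`. -/
def HasUniformStrategy (G : ParamGame W T E F) (ε : ℝ) (K : ℕ) : Prop :=
  ∃ w : Fin K → W, (∀ k, w k ∈ G.Ω) ∧
    ∀ r ∈ G.hullG, G.value - ε ≤ G.modelPayoff (∑ k, (1 / (K : ℝ)) • G.f (w k)) r

/-- Replacing a nearly optimal mixture by any single model loses at most `D_w` against each `θ`.
This disposes of the case `D_w ≤ ε` in the Euclidean bound. -/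
theorem hasUniformStrategy_one (hB : G.IsBilinear) (hb : G.IsBoundedPayoff) (hΩ : G.Ω.Nonempty)
    {ε : ℝ} (hε : G.Dw ≤ ε) : G.HasUniformStrategy ε 1 := by
  obtain ⟨w, hw⟩ := hΩ
  refine ⟨fun _ => w, fun _ => hw, fun r hr => ?_⟩
  simp only [Nat.cast_one, div_one, one_smul, Finset.univ_unique, Finset.sum_const,
    Finset.card_singleton]
  refine hB.le_modelPayoff_right (f_mem_hullF hw) (fun θ hθ => ?_) hr
  refine le_of_forall_pos_le_add fun δ hδ => ?_
  obtain ⟨g, hg, hgr⟩ := exists_value_sub_le hB hb ⟨w, hw⟩ hδ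
  have h1 := hgr _ (q_mem_hullG hθ)
  have h2 : G.modelPayoff g (G.q θ) ≤ G.payoff w θ + G.Dw :=
    hB.modelPayoff_le (q_mem_hullG hθ) (fun w' hw' => by
      have := hb.sub_le_Dw hw' hw hθ
      rw [payoff] at this
      linarith) hg
  rw [payoff] at h2
  linarith

/-- Secured values of both players make up an equilibrium, and the two sizes are independent. -/
theorem hasEquilibriumBound_of_hasUniformStrategy (hv : G.value = G.upperValue) {ε B B' : ℝ}
    {K K' : ℕ} (hK0 : 0 < K) (hK0' : 0 < K') (hK : G.HasUniformStrategy ε K)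
    (hK' : G.swap.HasUniformStrategy ε K') (hB : (K : ℝ) ≤ B) (hB' : (K' : ℝ) ≤ B') :
    G.HasEquilibriumBound ε B B' := by
  classical
  have unif : ∀ {n : ℕ}, 0 < n → (fun _ : Fin n => 1 / (n : ℝ)) ∈ stdSimplex ℝ (Fin n) :=
    fun {n} hn => ⟨fun _ => by positivity, by simp [(Nat.cast_pos (α := ℝ).2 hn).ne']⟩
  obtain ⟨w, hw, hwr⟩ := hK
  obtain ⟨θ, hθ, hθr⟩ := hK'
  have hθr' : ∀ g ∈ G.hullF,
      G.modelPayoff g (∑ k, (1 / (K' : ℝ)) • G.q (θ k)) ≤ G.value + ε := by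
    intro g hg
    have : G.swap.value - ε ≤ -G.modelPayoff g (∑ k, (1 / (K' : ℝ)) • G.q (θ k)) := hθr g hg
    rw [swap_value, ← hv] at this
    linarith
  have heq : G.IsEpsEquilibrium ε (∑ k, (1 / (K : ℝ)) • G.f (w k))
      (∑ k, (1 / (K' : ℝ)) • G.q (θ k)) :=
    ⟨sum_mem_hullF (unif hK0).1 (unif hK0).2 hw,
      sum_mem_hullF (G := G.swap) (unif hK0').1 (unif hK0').2 hθ, hwr, hθr'⟩
  have hmem : (K, K') ∈ G.equilibriumSizes ε :=
    ⟨_, unif hK0, _, unif hK0', w, θ, hw, hθ, heq⟩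
  refine ⟨hv, ?_, K, K', ⟨hK0, hK0', w, θ, hw, hθ, heq⟩, hB, hB'⟩
  -- `IsLeast` in the product order asks for both coordinates to be minimal at once. Each is
  -- minimized alone, and the first half of one equilibrium is then paired with the second half of
  -- the other.
  have hex₁ : ∃ n n', (n, n') ∈ G.equilibriumSizes ε := ⟨K, K', hmem⟩
  have hex₂ : ∃ n' n, (n, n') ∈ G.equilibriumSizes ε := ⟨K', K, hmem⟩
  obtain ⟨m', l, hl, -, -, w₁, -, hw₁, -, hg, -, hgr, -⟩ := Nat.find_spec hex₁
  obtain ⟨m, -, -, l', hl', -, θ₁, -, hθ₁, -, hr, -, hrg⟩ := Nat.find_spec hex₂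
  refine ⟨Nat.find hex₁, Nat.find hex₂,
    ⟨⟨l, hl, l', hl', w₁, θ₁, hw₁, hθ₁, hg, hr, hgr, hrg⟩, ?_⟩, ?_, ?_⟩
  · rintro ⟨n, n'⟩ hn
    exact ⟨Nat.find_min' hex₁ ⟨n', hn⟩, Nat.find_min' hex₂ ⟨n, hn⟩⟩
  · exact le_trans (by exact_mod_cast Nat.find_min' hex₁ ⟨K', hmem⟩) hB
  · exact le_trans (by exact_mod_cast Nat.find_min' hex₂ ⟨K, hmem⟩) hB'

end Models

/-! ### Lipschitz payoffs: nets, minimax and sampled strategies -/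

section Metric

variable {W T E F : Type*} [PseudoMetricSpace W] [PseudoMetricSpace T]

theorem IsLipschitz.swap {G : ParamGame W T E F} {L : ℝ} (h : G.IsLipschitz L) :
    G.swap.IsLipschitz L := by
  refine ⟨fun θ hθ θ' hθ' w hw => ?_, fun θ hθ w hw w' hw' => ?_⟩
  · rw [swap_payoff, swap_payoff, neg_sub_neg, abs_sub_comm]
    exact h.2 w hw θ hθ θ' hθ'
  · rw [swap_payoff, swap_payoff, neg_sub_neg, abs_sub_comm]
    exact h.1 w hw w' hw' θ hθ

theorem IsLipschitz.isBoundedPayoff {G : ParamGame W T E F} {L : ℝ} (h : G.IsLipschitz L)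
    (hL : 0 ≤ L) (hΩ : Bornology.IsBounded G.Ω) (hΘ : Bornology.IsBounded G.Θ) :
    G.IsBoundedPayoff := by
  rcases G.Ω.eq_empty_or_nonempty with h0 | ⟨w₀, hw₀⟩
  · exact ⟨0, by simp [h0]⟩
  rcases G.Θ.eq_empty_or_nonempty with h0 | ⟨θ₀, hθ₀⟩
  · exact ⟨0, by simp [h0]⟩
  refine ⟨|G.payoff w₀ θ₀| + L * Metric.diam G.Ω + L * Metric.diam G.Θ, fun w hw θ hθ => ?_⟩
  have h1 := (h.1 w hw w₀ hw₀ θ hθ).trans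
    (mul_le_mul_of_nonneg_left (Metric.dist_le_diam_of_mem hΩ hw hw₀) hL)
  have h2 := (h.2 w₀ hw₀ θ hθ θ₀ hθ₀).trans
    (mul_le_mul_of_nonneg_left (Metric.dist_le_diam_of_mem hΘ hθ hθ₀) hL)
  have h3 := abs_add_three (G.payoff w θ - G.payoff w₀ θ) (G.payoff w₀ θ - G.payoff w₀ θ₀)
    (G.payoff w₀ θ₀)
  rw [show G.payoff w θ - G.payoff w₀ θ + (G.payoff w₀ θ - G.payoff w₀ θ₀) + G.payoff w₀ θ₀ =
    G.payoff w θ by ring] at h3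
  linarith

variable [AddCommGroup E] [Module ℝ E] [AddCommGroup F] [Module ℝ F] {G : ParamGame W T E F}
  {L : ℝ}

theorem IsLipschitz.abs_modelPayoff_sub_le (h : G.IsLipschitz L) (hB : G.IsBilinear) {g : E}
    (hg : g ∈ G.hullF) {θ θ' : T} (hθ : θ ∈ G.Θ) (hθ' : θ' ∈ G.Θ) :
    |G.modelPayoff g (G.q θ) - G.modelPayoff g (G.q θ')| ≤ L * dist θ θ' := by
  obtain ⟨ι, _, l, w, hl, hl1, hw, rfl⟩ := exists_weights_of_mem_hullF hg
  rw [hB.modelPayoff_sum (q_mem_hullG hθ) hl hl1 hw,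
    hB.modelPayoff_sum (q_mem_hullG hθ') hl hl1 hw, ← Finset.sum_sub_distrib]
  calc _ ≤ ∑ i, l i * (L * dist θ θ') := (Finset.abs_sum_le_sum_abs _ _).trans
        (Finset.sum_le_sum fun i _ => by
          rw [← mul_sub, abs_mul, abs_of_nonneg (hl i)]
          exact mul_le_mul_of_nonneg_left (h.2 _ (hw i) _ hθ _ hθ') (hl i))
    _ = _ := by rw [← Finset.sum_mul, hl1, one_mul]

/-- A lower bound of the payoff on a net of the second player's parameters extends to all models
of the second player. -/
theorem IsLipschitz.le_modelPayoff_of_net (h : G.IsLipschitz L) (hL : 0 ≤ L) (hB : G.IsBilinear)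
    {S : Finset T} {ρ : ℝ} (hS : ∀ θ ∈ S, θ ∈ G.Θ) (hcov : ∀ θ ∈ G.Θ, ∃ θ' ∈ S, dist θ θ' ≤ ρ)
    {g : E} (hg : g ∈ G.hullF) {c : ℝ} (hc : ∀ θ ∈ S, c ≤ G.modelPayoff g (G.q θ)) {r : F}
    (hr : r ∈ G.hullG) : c - L * ρ ≤ G.modelPayoff g r := by
  refine hB.le_modelPayoff_right hg (fun θ hθ => ?_) hr
  obtain ⟨θ', hθ', hd⟩ := hcov θ hθ
  have h1 := (abs_le.1 (h.abs_modelPayoff_sub_le hB hg hθ (hS θ' hθ'))).1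
  have h2 := hc θ' hθ'
  have h3 := mul_le_mul_of_nonneg_left hd hL
  linarith

/-- Total boundedness makes the covering number finite, so `toNat` loses nothing and a minimal cover
realizes it. -/
theorem _root_.TotallyBounded.exists_finset_net {X : Type*} [PseudoMetricSpace X] {A : Set X}
    (hA : TotallyBounded A) {ρ : ℝ} (hρ : 0 < ρ) :
    ∃ S : Finset X, (∀ x ∈ S, x ∈ A) ∧ (∀ x ∈ A, ∃ y ∈ S, dist x y ≤ ρ) ∧
      Real.log S.card = logCoveringNumber A ρ := by
  have hne : ρ.toNNReal ≠ 0 := by simpa using hρ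
  obtain ⟨C₀, hC₀, hfin₀, hcov₀⟩ := Metric.exists_finite_isCover_of_totallyBounded hne hA
  obtain ⟨C, hC, hfin, hcov, hcard⟩ := Metric.exists_set_encard_eq_coveringNumber
    (ne_top_of_le_ne_top hfin₀.encard_lt_top.ne (hcov₀.coveringNumber_le_encard hC₀))
  refine ⟨hfin.toFinset, fun x hx => hC (by simpa using hx), fun x hx => ?_, ?_⟩
  · have := Metric.isCover_iff_subset_iUnion_closedBall.1 hcov hx
    simp only [Set.mem_iUnion, Metric.mem_closedBall, exists_prop] at this
    obtain ⟨y, hy, hxy⟩ := this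
    exact ⟨y, by simpa using hy, by rwa [Real.coe_toNNReal _ hρ.le] at hxy⟩
  · rw [logCoveringNumber, ← hcard, hfin.encard_eq_coe_toFinset_card, ENat.toNat_natCast]

/-- The minimax theorem for the convexified game. -/
theorem value_eq_upperValue (hB : G.IsBilinear) (hL : 0 < L) (h : G.IsLipschitz L)
    (hΩ : G.Ω.Nonempty) (hΘ : G.Θ.Nonempty) (hΩt : TotallyBounded G.Ω)
    (hΘt : TotallyBounded G.Θ) : G.value = G.upperValue := by
  have hb := h.isBoundedPayoff hL.le hΩt.isBounded hΘt.isBounded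
  refine (value_le_upperValue hB hb hΩ hΘ).antisymm (le_of_forall_pos_le_add fun δ hδ => ?_)
  -- Each player's net costs `δ / 2`, hence `δ` in total.
  have hρ : 0 < δ / (2 * L) := by positivity
  have hLρ : L * (δ / (2 * L)) = δ / 2 := by field_simp
  obtain ⟨S, hS, hScov, -⟩ := hΩt.exists_finset_net hρ
  obtain ⟨S', hS', hScov', -⟩ := hΘt.exists_finset_net hρ
  obtain ⟨w₀, hw₀⟩ := hΩ
  obtain ⟨θ₀, hθ₀⟩ := hΘ
  have : Nonempty (Fin S.card) := by
    obtain ⟨y, hy, -⟩ := hScov w₀ hw₀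
    exact ⟨S.equivFin ⟨y, hy⟩⟩
  have : Nonempty (Fin S'.card) := by
    obtain ⟨y, hy, -⟩ := hScov' θ₀ hθ₀
    exact ⟨S'.equivFin ⟨y, hy⟩⟩
  let w : Fin S.card → W := fun i => S.equivFin.symm i
  let θ : Fin S'.card → T := fun j => S'.equivFin.symm j
  have hw : ∀ i, w i ∈ G.Ω := fun i => hS _ (S.equivFin.symm i).2
  have hθ : ∀ j, θ j ∈ G.Θ := fun j => hS' _ (S'.equivFin.symm j).2
  obtain ⟨x, hx, y, hy, v, h1, h2⟩ := exists_saddle_of_matrix fun i j => G.payoff (w i) (θ j)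
  have hg := sum_mem_hullF (G := G) hx.1 hx.2 hw
  have hr := sum_mem_hullF (G := G.swap) hy.1 hy.2 hθ
  have e1 : v - δ / 2 ≤ G.value := by
    refine le_value hB hb ⟨θ₀, hθ₀⟩ hg fun r' hr' => ?_
    rw [← hLρ]
    refine h.le_modelPayoff_of_net hL.le hB hS' hScov' hg (fun t ht => ?_) hr'
    rw [hB.modelPayoff_sum (q_mem_hullG (hS' t ht)) hx.1 hx.2 hw]
    simpa [θ, payoff] using h1 (S'.equivFin ⟨t, ht⟩)
  have e2 : -v - δ / 2 ≤ G.swap.value := by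
    refine le_value hB.swap hb.swap ⟨w₀, hw₀⟩ hr fun r' hr' => ?_
    rw [← hLρ]
    refine h.swap.le_modelPayoff_of_net hL.le hB.swap hS hScov hr (fun t ht => ?_) hr'
    rw [hB.swap.modelPayoff_sum (q_mem_hullG (G := G.swap) (hS t ht)) hy.1 hy.2 hθ]
    have := h2 (S.equivFin ⟨t, ht⟩)
    simp only [w, Equiv.symm_apply_apply] at this
    simp only [ParamGame.swap, mul_neg, Finset.sum_neg_distrib]
    exact neg_le_neg this
  rw [swap_value] at e2
  linarith

/-- The error `ε` is split into `L * ρ` for leaving the net and the rest for sampling, up to an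
arbitrarily small part for the choice of the mixture. -/
theorem hasUniformStrategy_of_net (hB : G.IsBilinear) (hL : 0 ≤ L) (h : G.IsLipschitz L)
    (hb : G.IsBoundedPayoff) (hΩ : G.Ω.Nonempty) (hΘ : G.Θ.Nonempty) {S : Finset T} {ρ ε : ℝ}
    (hS : ∀ θ ∈ S, θ ∈ G.Θ) (hcov : ∀ θ ∈ G.Θ, ∃ θ' ∈ S, dist θ θ' ≤ ρ) (hρ : L * ρ < ε) {K : ℕ}
    (hK0 : 0 < K) (hK : G.Dw ^ 2 * Real.log S.card < 2 * K * (ε - L * ρ) ^ 2) :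
    G.HasUniformStrategy ε K := by
  obtain ⟨w₀, hw₀⟩ := hΩ
  obtain ⟨θ₀, hθ₀⟩ := hΘ
  have hD0 : 0 ≤ G.Dw := by simpa using hb.sub_le_Dw hw₀ hw₀ hθ₀
  -- The slack `η` serves twice: the value need not be attained, and `G.Dw` may be `0` while
  -- sampling needs a positive range. The strict inequality `hK` survives for small `η`.
  obtain ⟨η, ⟨hη1, hη2⟩, hη0⟩ : ∃ η : ℝ, (η < ε - L * ρ ∧
      (G.Dw + η) ^ 2 * Real.log S.card < 2 * K * (ε - L * ρ - η) ^ 2) ∧ 0 < η := by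
    have h1 : ∀ᶠ η : ℝ in nhds 0, η < ε - L * ρ := eventually_lt_nhds (by linarith)
    have h2 : ∀ᶠ η : ℝ in nhds 0,
        (G.Dw + η) ^ 2 * Real.log S.card < 2 * K * (ε - L * ρ - η) ^ 2 :=
      ContinuousAt.eventually_lt (by fun_prop) (by fun_prop) (by simpa using hK)
    exact (((h1.and h2).filter_mono nhdsWithin_le_nhds).and
      (self_mem_nhdsWithin (s := Set.Ioi (0 : ℝ)))).exists
  obtain ⟨g, hg, hgr⟩ := exists_value_sub_le hB hb ⟨w₀, hw₀⟩ hη0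
  obtain ⟨ι, _, l, w, hl, hl1, hw, rfl⟩ := exists_weights_of_mem_hullF hg
  obtain ⟨σ, hσ⟩ := exists_sample_average hl hl1 (X := fun i θ => G.payoff (w i) θ) (S := S)
    (fun θ hθ i j => (hb.sub_le_Dw (hw i) (hw j) (hS θ hθ)).trans
      (le_add_of_nonneg_right hη0.le)) (by linarith) (by linarith) hη2
  have hK' : (0 : ℝ) < K := by exact_mod_cast hK0
  have hu : ∀ _ : Fin K, 0 ≤ 1 / (K : ℝ) := fun _ => by positivity
  have hu1 : ∑ _ : Fin K, 1 / (K : ℝ) = 1 := by simp [hK'.ne']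
  refine ⟨fun k => w (σ k), fun k => hw _, fun r hr => ?_⟩
  have := h.le_modelPayoff_of_net hL hB hS hcov (sum_mem_hullF hu hu1 fun k => hw (σ k))
    (c := G.value - ε + L * ρ) (fun θ hθ => ?_) hr
  · linarith
  · have h1 := hgr _ (q_mem_hullG (hS θ hθ))
    rw [hB.modelPayoff_sum (q_mem_hullG (hS θ hθ)) hl hl1 hw] at h1
    rw [hB.modelPayoff_sum (q_mem_hullG (hS θ hθ)) hu hu1 fun k => hw (σ k), ← Finset.mul_sum]
    have h2 := hσ θ hθ
    rw [one_div, ← div_eq_inv_mul, le_div_iff₀ hK']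
    refine le_trans ?_ h2
    rw [mul_comm]
    refine mul_le_mul_of_nonneg_left ?_ hK'.le
    change _ ≤ ∑ i, l i * G.modelPayoff (G.f (w i)) (G.q θ) - _
    linarith

theorem exists_hasUniformStrategy_of_totallyBounded (hB : G.IsBilinear) (hL : 0 < L)
    (h : G.IsLipschitz L) (hb : G.IsBoundedPayoff) (hΩ : G.Ω.Nonempty) (hΘ : G.Θ.Nonempty)
    (hΘt : TotallyBounded G.Θ) {ε : ℝ} (hε : 0 < ε) :
    ∃ K : ℕ, 0 < K ∧
      (K : ℝ) ≤ max 1 (4 * G.Dw ^ 2 / ε ^ 2 * logCoveringNumber G.Θ (ε / (2 * L))) ∧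
      G.HasUniformStrategy ε K := by
  obtain ⟨S, hS, hcov, hlog⟩ := hΘt.exists_finset_net (show 0 < ε / (2 * L) by positivity)
  have hlog0 : 0 ≤ Real.log S.card := Real.log_natCast_nonneg _
  rw [← hlog]
  -- With `ε / 2` left for sampling, any `K > x` works. The bound is `2 * x`, which leaves room for
  -- rounding if `x ≥ 1`; otherwise `K = 1`.
  obtain ⟨K, hK0, hxK, hKB⟩ := exists_nat_gt_and_le_max
    (x := 2 * G.Dw ^ 2 / ε ^ 2 * Real.log S.card)
    (B := 4 * G.Dw ^ 2 / ε ^ 2 * Real.log S.card) (by positivity) (by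
      rcases lt_or_ge (2 * G.Dw ^ 2 / ε ^ 2 * Real.log S.card) 1 with h1 | h1
      · exact Or.inr h1
      · left
        have : 4 * G.Dw ^ 2 / ε ^ 2 * Real.log S.card =
          2 * (2 * G.Dw ^ 2 / ε ^ 2 * Real.log S.card) := by ring
        linarith)
  have hLρ : L * (ε / (2 * L)) = ε / 2 := by field_simp
  refine ⟨K, hK0, hKB, hasUniformStrategy_of_net hB hL.le h hb hΩ hΘ hS hcov (by linarith) hK0 ?_⟩
  rw [hLρ]
  have : 2 * G.Dw ^ 2 / ε ^ 2 * Real.log S.card =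
    2 * (G.Dw ^ 2 * Real.log S.card) / ε ^ 2 := by ring
  rw [this, div_lt_iff₀ (by positivity)] at hxK
  linarith

end Metric

/-! ### Euclidean parameter sets -/

theorem exists_hasUniformStrategy_of_norm_le {d p : ℕ} {E F : Type*} [AddCommGroup E]
    [Module ℝ E] [AddCommGroup F] [Module ℝ F]
    {G : ParamGame (EuclideanSpace ℝ (Fin d)) (EuclideanSpace ℝ (Fin p)) E F} {L R ε : ℝ}
    (hB : G.IsBilinear) (hL : 0 < L) (h : G.IsLipschitz L) (hb : G.IsBoundedPayoff)
    (hΩ : G.Ω.Nonempty) (hΘ : G.Θ.Nonempty) (hΩR : ∀ w ∈ G.Ω, ‖w‖ ≤ R)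
    (hΘR : ∀ θ ∈ G.Θ, ‖θ‖ ≤ R) (hε : 0 < ε) :
    ∃ K : ℕ, 0 < K ∧
      (K : ℝ) ≤ max 1 (4 * G.Dw ^ 2 * p / ε ^ 2 * Real.log (4 * L * R * √p / ε)) ∧
      G.HasUniformStrategy ε K := by
  rcases le_or_gt G.Dw ε with hD | hD
  · exact ⟨1, one_pos, by simp, hasUniformStrategy_one hB hb hΩ hD⟩
  have hR : 0 ≤ R := by
    obtain ⟨w, hw⟩ := hΩ
    exact (norm_nonneg _).trans (hΩR w hw)
  have hDLR : G.Dw ≤ 2 * L * R := by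
    obtain ⟨w, hw⟩ := hΩ
    obtain ⟨θ, hθ⟩ := hΘ
    refine csSup_le ⟨_, w, hw, w, hw, θ, hθ, rfl⟩ ?_
    rintro _ ⟨w, hw, w', hw', θ, hθ, rfl⟩
    have h1 := (le_abs_self _).trans (h.1 w hw w' hw' θ hθ)
    have h2 : dist w w' ≤ 2 * R := by
      rw [dist_eq_norm]
      linarith [norm_sub_le w w', hΩR w hw, hΩR w' hw']
    have h3 := mul_le_mul_of_nonneg_left h2 hL.le
    linarith
  rcases Nat.eq_zero_or_pos p with rfl | hp
  -- In dimension `0` a one-point net of radius `0` suffices.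
  · obtain ⟨S, hS, hcard, hcov⟩ := exists_net_of_norm_le hΘ hΘR one_pos
    refine ⟨1, one_pos, by simp, hasUniformStrategy_of_net hB hL.le h hb hΩ hΘ hS hcov
      (by simpa using hε) one_pos ?_⟩
    have : Real.log S.card = 0 :=
      le_antisymm (Real.log_nonpos (by positivity) (by exact_mod_cast hcard))
        (Real.log_natCast_nonneg _)
    rw [this]
    simp
    positivity
  -- In the normalized constants `c = D_w² / ε²` and `v = 4 L R √p / ε`, this is the inequality `D_w
  -- ≤ 2 L R`.
  have hcv : 4 * (G.Dw ^ 2 / ε ^ 2) * p ≤ (4 * L * R * √p / ε) ^ 2 := by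
    rw [div_pow, mul_pow, Real.sq_sqrt (by positivity), ← mul_div_assoc, div_mul_eq_mul_div]
    refine div_le_div_of_nonneg_right (mul_le_mul_of_nonneg_right ?_ (by positivity))
      (by positivity)
    nlinarith
  obtain ⟨K, m, hK0, hm, hKB, hvm, hcK⟩ := exists_sample_and_grid_size hp
    (c := G.Dw ^ 2 / ε ^ 2) (v := 4 * L * R * √p / ε)
    (by rw [one_lt_div (by positivity)]; gcongr) (by positivity) hcv
  obtain ⟨S, hS, hcard, hcov⟩ := exists_net_of_norm_le hΘ hΘR hm
  have hLρ : L * (2 * R * √p / m) = ε * (4 * L * R * √p / ε / (2 * m)) := by field_simp; ring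
  refine ⟨K, hK0, hKB.trans (le_of_eq ?_),
    hasUniformStrategy_of_net hB hL.le h hb hΩ hΘ hS hcov ?_ hK0 ?_⟩
  · congr 2
    ring
  · rw [hLρ]
    exact mul_lt_of_lt_one_right hε hvm
  · rw [hLρ]
    have hlog : Real.log S.card ≤ p * Real.log m := by
      rw [← Real.log_pow]
      obtain ⟨θ, hθ⟩ := hΘ
      obtain ⟨y, hy, -⟩ := hcov θ hθ
      exact Real.log_le_log (by exact_mod_cast Finset.card_pos.2 ⟨y, hy⟩)
        (by exact_mod_cast hcard)
    calc G.Dw ^ 2 * Real.log S.card ≤ G.Dw ^ 2 * (p * Real.log m) := by gcongr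
      _ = ε ^ 2 * (G.Dw ^ 2 / ε ^ 2 * (p * Real.log m)) := by field_simp
      _ < ε ^ 2 * (2 * K * (1 - 4 * L * R * √p / ε / (2 * m)) ^ 2) := by gcongr
      _ = _ := by ring

end ParamGame

theorem theorem2 :
    -- parameter sets in arbitrary metric spaces, in terms of covering numbers
    (∀ {W T E F : Type*} [PseudoMetricSpace W] [PseudoMetricSpace T]
      [AddCommGroup E] [Module ℝ E] [AddCommGroup F] [Module ℝ F]
      (G : ParamGame W T E F) (L ε : ℝ),
      G.Ω.Nonempty → G.Θ.Nonempty → TotallyBounded G.Ω → TotallyBounded G.Θ →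
      G.IsBilinear → 0 < L → G.IsLipschitz L → 0 < ε →
      G.HasEquilibriumBound ε
        (max 1 (4 * G.Dw ^ 2 / ε ^ 2 * logCoveringNumber G.Θ (ε / (2 * L))))
        (max 1 (4 * G.Dθ ^ 2 / ε ^ 2 * logCoveringNumber G.Ω (ε / (2 * L))))) ∧
    -- norm-bounded parameter sets in Euclidean spaces
    (∀ {d p : ℕ} {E F : Type*}
      [AddCommGroup E] [Module ℝ E] [AddCommGroup F] [Module ℝ F]
      (G : ParamGame (EuclideanSpace ℝ (Fin d)) (EuclideanSpace ℝ (Fin p)) E F) (L R ε : ℝ),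
      G.Ω.Nonempty → G.Θ.Nonempty → (∀ w ∈ G.Ω, ‖w‖ ≤ R) → (∀ θ ∈ G.Θ, ‖θ‖ ≤ R) →
      G.IsBilinear → 0 < L → G.IsLipschitz L → 0 < ε →
      G.HasEquilibriumBound ε
        (max 1 (4 * G.Dw ^ 2 * p / ε ^ 2 * Real.log (4 * L * R * √p / ε)))
        (max 1 (4 * G.Dθ ^ 2 * d / ε ^ 2 * Real.log (4 * L * R * √d / ε)))) := by
  refine ⟨?_, ?_⟩
  · intro W T E F _ _ _ _ _ _ G L ε hΩ hΘ hΩt hΘt hB hL h hε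
    have hb := h.isBoundedPayoff hL.le hΩt.isBounded hΘt.isBounded
    obtain ⟨K, hK0, hKB, hK⟩ :=
      ParamGame.exists_hasUniformStrategy_of_totallyBounded hB hL h hb hΩ hΘ hΘt hε
    obtain ⟨K', hK0', hKB', hK'⟩ := ParamGame.exists_hasUniformStrategy_of_totallyBounded hB.swap
      hL h.swap hb.swap hΘ hΩ hΩt hε
    rw [ParamGame.swap_Dw] at hKB'
    exact ParamGame.hasEquilibriumBound_of_hasUniformStrategy
      (ParamGame.value_eq_upperValue hB hL h hΩ hΘ hΩt hΘt) hK0 hK0' hK hK' hKB hKB'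
  · intro d p E F _ _ _ _ G L R ε hΩ hΘ hΩR hΘR hB hL h hε
    have hΩb : Bornology.IsBounded G.Ω := isBounded_iff_forall_norm_le.2 ⟨R, hΩR⟩
    have hΘb : Bornology.IsBounded G.Θ := isBounded_iff_forall_norm_le.2 ⟨R, hΘR⟩
    have hb := h.isBoundedPayoff hL.le hΩb hΘb
    obtain ⟨K, hK0, hKB, hK⟩ :=
      ParamGame.exists_hasUniformStrategy_of_norm_le hB hL h hb hΩ hΘ hΩR hΘR hε
    obtain ⟨K', hK0', hKB', hK'⟩ := ParamGame.exists_hasUniformStrategy_of_norm_le hB.swap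
      hL h.swap hb.swap hΘ hΩ hΘR hΩR hε
    rw [ParamGame.swap_Dw] at hKB'
    exact ParamGame.hasEquilibriumBound_of_hasUniformStrategy
      (ParamGame.value_eq_upperValue hB hL h hΩ hΘ
        (hΩb.isCompact_closure.totallyBounded.subset subset_closure)
        (hΘb.isCompact_closure.totallyBounded.subset subset_closure))
      hK0 hK0' hK hK' hKB hKB'
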